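/- Let $\Gamma$ be a discrete group and let $S\subset\Gamma$ be a finite symmetric generating set with $e\notin S$. Let $\varphi:\Gamma\to\mathbb{C}$ be positive definite, i.e. $\sum_{i,j}c_i\overline{c_j}\varphi(g_ig_j^{-1})\geqslant 0$ for all finite families $c_i\in\mathbb{C}$, $g_i\in\Gamma$, and assume that $\varphi(g)\geqslant 0$ for all $g\in S$. Let $S(1)$ be the unit sphere of the word length of $S$ (that is, $S(1)=S$), put $\varphi^{+}(1)=-\inf_{g\in S(1)}\ln|\varphi(g)|$ and assume $0<\varphi^{+}(1)<\infty$. Let $r_i$ be the number of reduced words of length $i$ in the letters of $S$ (words in which no letter is followed by its inverse) which are trivial in $\Gamma$. The cogrowth rate $\gamma(S)$ is the limit of $r_i^{1/i}$ along the indices $i$ with $r_i\neq 0$ (equivalently $\limsup_i r_i^{1/i}$) if $r_i\neq 0$ for some $i\geqslant 1$, and $\gamma(S)=\sqrt{|S|-1}$ otherwise (i.e. if $\Gamma$ is free on $S$). For a function $\psi$ on $\Gamma$, let $\|\psi\|\in[0,\infty]$ be one half of the norm of $\psi$ as a linear form on the group von Neumann algebra $L(\Gamma)\subset B(\ell^2(\Gamma))$,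 that is, one half of the minimal norm of a bounded linear functional $\Phi$ on $L(\Gamma)$ with $\Phi(\lambda(g))=\psi(g)$ for all $g\in\Gamma$ ($\lambda$ being the left regular representation), and $\|\psi\|=\infty$ if there is no such functional. Then, for every $c>0$ such that $$k=\frac{\ln(|S|-1)}{2\varphi^{+}(1)}-c$$ is a non-negative integer, $$\|\varphi^{k}-\delta_e\|\geqslant 1-4\left(2+3\,\frac{\gamma(S)^2}{|S|}\right)e^{-2\varphi^{+}(1)c},$$ where $\varphi^k$ is the pointwise power and $\delta_e$ is the Dirac mass at the neutral element (the canonical trace). -/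

import Mathlib

open scoped ENNReal ComplexOrder Pointwise lp

namespace DualCutoff

/-- A function `φ : Γ → ℂ` is positive definite if `∑ i j, c i * conj (c j) * φ (g i * (g j)⁻¹) ≥ 0`
for all finite families `c` of complex numbers and `g` of elements of `Γ`. -/
def IsPositiveDefinite {Γ : Type*} [Group Γ] (φ : Γ → ℂ) : Prop :=
  ∀ (n : ℕ) (c : Fin n → ℂ) (g : Fin n → Γ),
    0 ≤ ∑ i, ∑ j, c i * (starRingEnd ℂ) (c j) * φ (g i * (g j)⁻¹)

/-- The canonical trace `δ_e`, as a function on the group. -/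
noncomputable def diracOne {Γ : Type*} [Group Γ] : Γ → ℂ :=
  Set.indicator {1} 1

section LeftRegular

theorem memlp_translate {Γ : Type*} [Group Γ] (g : Γ) (f : ℓ²(Γ, ℂ)) :
    Memℓp (fun h : Γ => f (g⁻¹ * h)) 2 := by
  have hf := lp.memℓp f
  rw [memℓp_gen_iff (by norm_num)] at hf ⊢
  exact (Equiv.mulLeft g⁻¹).summable_iff.mpr hf

/-- The operator `λ(g)` of the left regular representation on `ℓ²(Γ)`:
`(λ(g) f)(h) = f(g⁻¹ h)`, as a linear isometry. -/
noncomputable def leftRegularIsometry {Γ : Type*} [Group Γ] (g : Γ) :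
    ℓ²(Γ, ℂ) →ₗᵢ[ℂ] ℓ²(Γ, ℂ) where
  toFun f := ⟨fun h => f (g⁻¹ * h), memlp_translate g f⟩
  map_add' _ _ := rfl
  map_smul' _ _ := rfl
  norm_map' f := by
    rw [lp.norm_eq_tsum_rpow (by norm_num), lp.norm_eq_tsum_rpow (by norm_num)]
    congr 1
    exact (Equiv.mulLeft g⁻¹).tsum_eq (fun h => ‖f h‖ ^ (2 : ℝ≥0∞).toReal)

/-- `λ(g)` as a bounded operator on `ℓ²(Γ)`. -/
noncomputable def leftRegular {Γ : Type*} [Group Γ] (g : Γ) : ℓ²(Γ, ℂ) →L[ℂ] ℓ²(Γ, ℂ) :=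
  (leftRegularIsometry g).toContinuousLinearMap

theorem leftRegular_apply {Γ : Type*} [Group Γ] (g : Γ) (f : ℓ²(Γ, ℂ)) (h : Γ) :
    leftRegular g f h = f (g⁻¹ * h) := rfl

/-- The commutant of `λ(Γ)` in `B(ℓ²(Γ))`. (`StarSubalgebra.centralizer ℂ s` is the commutant of
`s` together with the adjoints of its elements.) -/
noncomputable def regularCommutant (Γ : Type*) [Group Γ] :
    StarSubalgebra ℂ (ℓ²(Γ, ℂ) →L[ℂ] ℓ²(Γ, ℂ)) :=
  StarSubalgebra.centralizer ℂ (Set.range (leftRegular (Γ := Γ)))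

/-- The group von Neumann algebra `L(Γ)`: the double commutant of `λ(Γ)` in `B(ℓ²(Γ))`. -/
noncomputable def groupVonNeumannAlgebra (Γ : Type*) [Group Γ] :
    VonNeumannAlgebra ℓ²(Γ, ℂ) where
  toStarSubalgebra := StarSubalgebra.centralizer ℂ
    (regularCommutant Γ : Set (ℓ²(Γ, ℂ) →L[ℂ] ℓ²(Γ, ℂ)))
  centralizer_centralizer' := by
    change Set.centralizer (Set.centralizer ((StarSubalgebra.centralizer ℂ
      (regularCommutant Γ : Set (ℓ²(Γ, ℂ) →L[ℂ] ℓ²(Γ, ℂ))) : StarSubalgebra ℂ _) :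
        Set (ℓ²(Γ, ℂ) →L[ℂ] ℓ²(Γ, ℂ)))) =
      ((StarSubalgebra.centralizer ℂ (regularCommutant Γ : Set (ℓ²(Γ, ℂ) →L[ℂ] ℓ²(Γ, ℂ))) :
        StarSubalgebra ℂ _) : Set (ℓ²(Γ, ℂ) →L[ℂ] ℓ²(Γ, ℂ)))
    rw [StarSubalgebra.coe_centralizer]
    exact Set.centralizer_centralizer_centralizer _

theorem leftRegular_mem {Γ : Type*} [Group Γ] (g : Γ) :
    leftRegular g ∈ (groupVonNeumannAlgebra Γ).toStarSubalgebra := by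
  change leftRegular g ∈ ((StarSubalgebra.centralizer ℂ ((StarSubalgebra.centralizer ℂ
    (Set.range (leftRegular (Γ := Γ))) : StarSubalgebra ℂ _) :
      Set (ℓ²(Γ, ℂ) →L[ℂ] ℓ²(Γ, ℂ))) : StarSubalgebra ℂ _) : Set (ℓ²(Γ, ℂ) →L[ℂ] ℓ²(Γ, ℂ)))
  rw [StarSubalgebra.coe_centralizer_centralizer]
  exact Set.subset_centralizer_centralizer (Or.inl ⟨g, rfl⟩)

/-- `λ(g)` as an element of `L(Γ)`. -/
noncomputable def groupUnitary {Γ : Type*} [Group Γ] (g : Γ) :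
    (groupVonNeumannAlgebra Γ).toStarSubalgebra :=
  ⟨leftRegular g, leftRegular_mem g⟩

end LeftRegular

/-- The total variation norm `‖ψ‖ = ½ ‖ψ‖_{L(Γ)^*}` of a function `ψ` on `Γ`, seen as a linear form
on `ℂ[Γ]`, with values in `[0, ∞]`: half of the smallest norm of a bounded linear functional on
`L(Γ)` taking the value `ψ g` at `λ(g)` for all `g`, and `∞` if `ψ` does not extend to a bounded
functional on `L(Γ)`. (When `ψ` has a normal extension to `L(Γ)`, that extension is unique and, by
Kaplansky's density theorem, it has the smallest norm among all bounded extensions.) -/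
noncomputable def tvNorm {Γ : Type*} [Group Γ] (ψ : Γ → ℂ) : ℝ≥0∞ :=
  ⨅ (Φ : (groupVonNeumannAlgebra Γ).toStarSubalgebra →L[ℂ] ℂ)
    (_ : ∀ g : Γ, Φ (groupUnitary g) = ψ g), ENNReal.ofReal (‖Φ‖ / 2)

/-- The word length `|g|_S = min {k | g ∈ S ^ k}` (used only for `S` symmetric and generating). -/
noncomputable def wordLength {Γ : Type*} [Group Γ] (S : Finset Γ) (g : Γ) : ℕ :=
  sInf {k : ℕ | g ∈ (S : Set Γ) ^ k}

/-- The sphere `S(i)` of radius `i` for the word length. -/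
def sphere {Γ : Type*} [Group Γ] (S : Finset Γ) (i : ℕ) : Set Γ :=
  {g | wordLength S g = i}

/-- `φ⁺(i) = - inf_{g ∈ S(i)} ln |φ(g)|`, as an extended real (with `ln 0 = -∞`). -/
noncomputable def phiPlus {Γ : Type*} [Group Γ] (S : Finset Γ) (φ : Γ → ℂ) (i : ℕ) : EReal :=
  -⨅ g ∈ sphere S i, ENNReal.log ‖φ g‖ₑ

/-- The reduced words of length `i` in the letters of the symmetric set `S` (no letter is followed
by its inverse) which are trivial in `Γ`, i.e. lie in the kernel of the quotient map onto `Γ`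
from the free group whose generators and their inverses are labelled by `S`. -/
def trivialReducedWords {Γ : Type*} [Group Γ] (S : Finset Γ) (i : ℕ) : Set (List Γ) :=
  {w | w.length = i ∧ (∀ s ∈ w, s ∈ S) ∧ w.IsChain (fun s t => t ≠ s⁻¹) ∧ w.prod = 1}

/-- The number `r_i` of reduced words of length `i` which are trivial in `Γ`. -/
noncomputable def numTrivial {Γ : Type*} [Group Γ] (S : Finset Γ) (i : ℕ) : ℕ :=
  (trivialReducedWords S i).ncard

open Classical in
/-- The cogrowth rate `γ(S)`: the limit of `r_i ^ (1 / i)` along the indices with `r_i ≠ 0`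
(equivalently the limsup of the whole sequence, which is bounded by `|S|`) if some nonempty
reduced word is trivial in `Γ`, and `√(|S| - 1)` if `Γ` is free on `S`. -/
noncomputable def cogrowthRate {Γ : Type*} [Group Γ] (S : Finset Γ) : ℝ :=
  if ∃ i, 1 ≤ i ∧ numTrivial S i ≠ 0 then
    Filter.limsup (fun i : ℕ => (numTrivial S i : ℝ) ^ (1 / (i : ℝ))) Filter.atTop
  else Real.sqrt ((S.card : ℝ) - 1)

end DualCutoff

namespace DualCutoff

/-! ### Positive definite functions and their powers. -/

section PositiveDefinite

variable {Γ : Type*} [Group Γ]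

/-! Put `ψ = φ ^ k`, `m = ψ 1`, `n = |S|`. If `ψ - δ_e` extends to a bounded `Φ` on `L(Γ)`, then `Ψ
= Φ + trace` is bounded and extends `ψ`, which is positive definite by Schur's product theorem.
Iterated Cauchy–Schwarz improves any bound on `Ψ` to `Ψ x ≤ m ‖x‖` for self-adjoint `x` in the group
algebra (`IsPositiveDefinite.re_map_le`). For `x = ∑ λ(s)` this gives `n e^{-ak} ≤ m ‖x‖`.

The cogrowth estimate `‖x‖ ≤ 2 max(γ, √(n-1))` (`norm_sum_leftRegular_le_cogrowthRate`) is a Schur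
test whose weight is the generating function of reduced words. As `n - 1 = e^{2a(k+c)}`, `m` is
therefore bounded below in terms of `e^{-2ac}` (`lower_bound_of_le`). Evaluation at the identity
gives `‖Φ‖ ≥ m - 1`; `φ 1` is not normalised, so `m` may be large. -/

theorem IsPositiveDefinite.apply_inv {φ : Γ → ℂ} (hφ : IsPositiveDefinite φ) (x : Γ) :
    φ x⁻¹ = star (φ x) := by
  -- Only the vanishing imaginary parts matter: coefficients `(1, 1)` compare the imaginary parts of
  -- `φ x` and `φ x⁻¹`, and `(i, 1)` their real parts.
  have h0 := (Complex.nonneg_iff.1 (hφ 1 ![1] ![1])).2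
  have h1 := (Complex.nonneg_iff.1 (hφ 2 ![1, 1] ![x, 1])).2
  have h2 := (Complex.nonneg_iff.1 (hφ 2 ![Complex.I, 1] ![x, 1])).2
  simp [Fin.sum_univ_two] at h0 h1 h2
  apply Complex.ext
  · simp; linarith
  · simp; linarith

theorem IsPositiveDefinite.posSemidef {φ : Γ → ℂ} (hφ : IsPositiveDefinite φ) {n : ℕ}
    (g : Fin n → Γ) : (Matrix.of fun i j => φ (g i * (g j)⁻¹)).PosSemidef := by
  refine Matrix.PosSemidef.of_dotProduct_mulVec_nonneg ?_ fun x => ?_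
  · ext i j
    simp [Matrix.conjTranspose_apply, ← hφ.apply_inv]
  · have h := hφ n (star x) g
    simp only [dotProduct, Matrix.mulVec, Matrix.of_apply, Finset.mul_sum]
    refine h.trans_eq (Finset.sum_congr rfl fun i _ => Finset.sum_congr rfl fun j _ => ?_)
    simp
    ring

theorem isPositiveDefinite_of_posSemidef {φ : Γ → ℂ}
    (h : ∀ (n : ℕ) (g : Fin n → Γ), (Matrix.of fun i j => φ (g i * (g j)⁻¹)).PosSemidef) :
    IsPositiveDefinite φ := by
  intro n c g
  have h := (h n g).dotProduct_mulVec_nonneg (star c)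
  simp only [dotProduct, Matrix.mulVec, Matrix.of_apply, Finset.mul_sum] at h
  refine h.trans_eq (Finset.sum_congr rfl fun i _ => Finset.sum_congr rfl fun j _ => ?_)
  simp
  ring

theorem isPositiveDefinite_one : IsPositiveDefinite (fun _ : Γ => (1 : ℂ)) := by
  intro n c g
  simp only [mul_one, ← Finset.mul_sum, ← Finset.sum_mul, ← map_sum]
  exact mul_star_self_nonneg _

theorem IsPositiveDefinite.mul {φ ψ : Γ → ℂ} (hφ : IsPositiveDefinite φ)
    (hψ : IsPositiveDefinite ψ) : IsPositiveDefinite (fun g => φ g * ψ g) :=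
  isPositiveDefinite_of_posSemidef fun _ g => (hφ.posSemidef g).hadamard (hψ.posSemidef g)

theorem IsPositiveDefinite.pow {φ : Γ → ℂ} (hφ : IsPositiveDefinite φ) (k : ℕ) :
    IsPositiveDefinite (fun g => φ g ^ k) := by
  induction k with
  | zero => simpa using isPositiveDefinite_one
  | succ k ih => simpa only [pow_succ] using ih.mul hφ

theorem IsPositiveDefinite.apply_one_nonneg {φ : Γ → ℂ} (hφ : IsPositiveDefinite φ) :
    0 ≤ φ 1 := by
  simpa using hφ 1 ![1] ![1]

end PositiveDefinite

/-! ### Functionals that are positive on the group algebra. -/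

section Moments

theorem pow_mem_span_range {Γ A : Type*} [Group Γ] [NormedRing A] [NormedAlgebra ℂ A]
    {u : Γ →* A} {x : A} (hx : x ∈ Submodule.span ℂ (Set.range u))
    (n : ℕ) : x ^ n ∈ Submodule.span ℂ (Set.range u) := by
  induction n with
  | zero => exact Submodule.subset_span ⟨1, by simp⟩
  | succ n ih =>
    rw [pow_succ]
    have h := Submodule.mul_mem_mul ih hx
    rw [Submodule.span_mul_span] at h
    refine Submodule.span_mono ?_ h
    rintro _ ⟨_, ⟨g, rfl⟩, _, ⟨k, rfl⟩, rfl⟩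
    exact ⟨g * k, map_mul u g k⟩

variable {Γ A : Type*} [Group Γ] [NormedRing A] [StarRing A] [NormedAlgebra ℂ A] [StarModule ℂ A]

theorem IsPositiveDefinite.map_mul_star_nonneg {ψ : Γ → ℂ} (hψ : IsPositiveDefinite ψ)
    {u : Γ →* A} (hu : ∀ g, star (u g) = u g⁻¹) (Ψ : A →ₗ[ℂ] ℂ) (hΨ : ∀ g, Ψ (u g) = ψ g) {y : A}
    (hy : y ∈ Submodule.span ℂ (Set.range u)) : 0 ≤ Ψ (y * star y) := by
  obtain ⟨n, c, v, rfl⟩ := Submodule.mem_span_set'.1 hy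
  choose g hg using fun i => (v i).2
  have h := hψ n c g
  simp only [← hg, star_sum, star_smul, hu, Finset.sum_mul, Finset.mul_sum,
    smul_mul_assoc, mul_smul_comm, ← map_mul, map_sum, map_smul, hΨ, smul_eq_mul]
  rw [Finset.sum_comm]
  refine h.trans_eq (Finset.sum_congr rfl fun i _ => Finset.sum_congr rfl fun j _ => ?_)
  simp
  ring

/-- Cauchy–Schwarz: the real quadratic `t ↦ Ψ ((t + y)(t + y)*)` is nonnegative, so its discriminant
is not positive. -/
theorem IsPositiveDefinite.re_map_sq_le {ψ : Γ → ℂ} (hψ : IsPositiveDefinite ψ)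
    {u : Γ →* A} (hu : ∀ g, star (u g) = u g⁻¹) (Ψ : A →ₗ[ℂ] ℂ) (hΨ : ∀ g, Ψ (u g) = ψ g) {y : A}
    (hy : y ∈ Submodule.span ℂ (Set.range u)) (hys : IsSelfAdjoint y) :
    (Ψ y).re ^ 2 ≤ (ψ 1).re * (Ψ (y ^ 2)).re := by
  have key : ∀ t : ℝ, 0 ≤ (ψ 1).re * (t * t) + (2 * (Ψ y).re) * t + (Ψ (y ^ 2)).re := by
    intro t
    have hm : (t : ℂ) • 1 + y ∈ Submodule.span ℂ (Set.range u) :=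
      add_mem (Submodule.smul_mem _ _ (Submodule.subset_span ⟨1, by simp⟩)) hy
    have h := (Complex.nonneg_iff.1 (hψ.map_mul_star_nonneg hu Ψ hΨ hm)).1
    have e : ((t : ℂ) • 1 + y) * star ((t : ℂ) • 1 + y) =
        ((t * t : ℝ) : ℂ) • 1 + ((2 * t : ℝ) : ℂ) • y + y ^ 2 := by
      rw [star_add, star_smul, hys.star_eq, star_one]
      have : star (t : ℂ) = t := Complex.conj_ofReal t
      simp only [this, add_mul, mul_add, smul_mul_assoc, mul_smul_comm, one_mul, mul_one,
        smul_add, smul_smul, sq, two_mul, Complex.ofReal_add, Complex.ofReal_mul, add_smul]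
      abel
    rw [e, ← map_one u] at h
    simp only [map_add, map_smul, hΨ, smul_eq_mul, Complex.add_re, Complex.re_ofReal_mul] at h
    linarith
  have h := discrim_le_zero key
  rw [discrim] at h
  nlinarith

/-- A bounded functional restricting to a positive definite function `ψ` is bounded by
`ψ 1 * ‖x‖` on self-adjoint elements `x` of the group algebra. -/
theorem IsPositiveDefinite.re_map_le {ψ : Γ → ℂ} (hψ : IsPositiveDefinite ψ)
    {u : Γ →* A} (hu : ∀ g, star (u g) = u g⁻¹) (Ψ : A →ₗ[ℂ] ℂ) (hΨ : ∀ g, Ψ (u g) = ψ g)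
    {C : ℝ} (hC0 : 0 ≤ C) (hC : ∀ y, ‖Ψ y‖ ≤ C * ‖y‖) {x : A}
    (hx : x ∈ Submodule.span ℂ (Set.range u)) (hxs : IsSelfAdjoint x) {K : ℝ} (hK : ‖x‖ ≤ K) :
    (Ψ x).re ≤ (ψ 1).re * K := by
  set m := (ψ 1).re with hm
  have hm0 : 0 ≤ m := (Complex.nonneg_iff.1 hψ.apply_one_nonneg).1
  have hK0 : 0 ≤ K := (norm_nonneg _).trans hK
  -- Cauchy–Schwarz iterated on `x, x², x⁴, …`; the factor `m` on the left avoids the exponent `2 ^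
  -- n - 1`.
  have step : ∀ n : ℕ, |(Ψ x).re| ^ (2 ^ n) * m ≤ m ^ (2 ^ n) * |(Ψ (x ^ 2 ^ n)).re| := by
    intro n
    induction n with
    | zero => simp [mul_comm]
    | succ n ih =>
      have h := hψ.re_map_sq_le hu Ψ hΨ (pow_mem_span_range hx (2 ^ n)) (hxs.pow _)
      rw [← pow_mul, ← pow_succ] at h
      rcases hm0.eq_or_lt with h0 | h0
      · simp [← h0]
      have h1 : (|(Ψ x).re| ^ (2 ^ n) * m) ^ 2 ≤ (m ^ (2 ^ n) * |(Ψ (x ^ 2 ^ n)).re|) ^ 2 := by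
        gcongr
      rw [mul_pow, mul_pow, sq_abs, ← pow_mul, ← pow_mul, ← pow_succ] at h1
      have h2 : m ^ 2 ^ (n + 1) * (Ψ (x ^ 2 ^ n)).re ^ 2 ≤
          m ^ 2 ^ (n + 1) * (m * |(Ψ (x ^ 2 ^ (n + 1))).re|) := by
        gcongr
        exact h.trans (by gcongr; exact le_abs_self _)
      have h3 := h1.trans h2
      refine le_of_mul_le_mul_right ?_ h0
      linarith
  have bound : ∀ n : ℕ, |(Ψ x).re| ^ (2 ^ n) * m ≤ C * (m * K) ^ (2 ^ n) := by
    intro n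
    refine (step n).trans ?_
    have : |(Ψ (x ^ 2 ^ n)).re| ≤ C * K ^ (2 ^ n) := by
      refine (Complex.abs_re_le_norm _).trans ((hC _).trans ?_)
      gcongr
      exact (norm_pow_le' _ (by positivity)).trans (by gcongr)
    rw [mul_pow]
    calc m ^ 2 ^ n * |(Ψ (x ^ 2 ^ n)).re| ≤ m ^ 2 ^ n * (C * K ^ (2 ^ n)) := by gcongr
      _ = _ := by ring
  rcases hm0.eq_or_lt with h0 | h0
  · have h := hψ.re_map_sq_le hu Ψ hΨ hx hxs
    rw [← hm, ← h0, zero_mul] at h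
    have := pow_eq_zero_iff (two_ne_zero) |>.1 (le_antisymm h (sq_nonneg _))
    rw [this, ← h0, zero_mul]
  -- Taking `2 ^ n`-th roots would remove `C`; equivalently, if `Ψ x > m K` then `C (m K / Ψ x) ^ (2
  -- ^ n)` tends to `0` although it is at least `m > 0`.
  by_contra! hlt
  have hpos : 0 ≤ m * K := by positivity
  have hE : 0 < (Ψ x).re := hpos.trans_lt hlt
  have hr : m * K / (Ψ x).re < 1 := (div_lt_one hE).2 hlt
  have lim := (tendsto_pow_atTop_nhds_zero_of_lt_one (by positivity) hr).const_mul C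
  have lim2 := lim.comp (tendsto_pow_atTop_atTop_of_one_lt (one_lt_two : (1 : ℕ) < 2))
  rw [mul_zero] at lim2
  obtain ⟨n, hn⟩ := (lim2.eventually (gt_mem_nhds h0)).exists
  have hb := bound n
  rw [abs_of_pos hE] at hb
  simp only [Function.comp, div_pow] at hn
  rw [← mul_div_assoc, div_lt_iff₀ (by positivity)] at hn
  linarith

end Moments

/-! ### The unitaries `λ(g)` in `L(Γ)`. -/

section GroupUnitaries

variable {Γ : Type*} [Group Γ]

theorem leftRegular_one : leftRegular (1 : Γ) = 1 := by
  ext f h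
  simp [leftRegular_apply]

theorem leftRegular_mul (g h : Γ) : leftRegular (g * h) = leftRegular g * leftRegular h := by
  ext f x
  simp [leftRegular_apply, mul_assoc]

theorem star_leftRegular (g : Γ) : star (leftRegular g) = leftRegular g⁻¹ := by
  rw [ContinuousLinearMap.star_eq_adjoint, eq_comm, ContinuousLinearMap.eq_adjoint_iff]
  intro x y
  have h := (leftRegularIsometry g).inner_map_map (leftRegular g⁻¹ x) y
  rw [← h]
  have : leftRegularIsometry g (leftRegular g⁻¹ x) = x := by
    change (leftRegular g * leftRegular g⁻¹) x = x
    rw [← leftRegular_mul, mul_inv_cancel, leftRegular_one]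
    rfl
  rw [this]
  rfl

/-- `g ↦ λ(g)` as a homomorphism into `L(Γ)`. -/
noncomputable def groupUnitaryHom (Γ : Type*) [Group Γ] :
    Γ →* (groupVonNeumannAlgebra Γ).toStarSubalgebra where
  toFun := groupUnitary
  map_one' := Subtype.ext leftRegular_one
  map_mul' g h := Subtype.ext (leftRegular_mul g h)

theorem star_groupUnitaryHom (g : Γ) : star (groupUnitaryHom Γ g) = groupUnitaryHom Γ g⁻¹ :=
  Subtype.ext (star_leftRegular g)

theorem isSelfAdjoint_sum_groupUnitaryHom (S : Finset Γ) (hsymm : ∀ s ∈ S, s⁻¹ ∈ S) :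
    IsSelfAdjoint (∑ s ∈ S, groupUnitaryHom Γ s) := by
  rw [IsSelfAdjoint, star_sum]
  simp only [star_groupUnitaryHom]
  exact Finset.sum_bij' (fun s _ => s⁻¹) (fun s _ => s⁻¹) hsymm hsymm (by simp) (by simp) (by simp)

end GroupUnitaries

/-! ### Schur test on the Cayley graph. -/

section SchurTest

variable {Γ : Type*} [Group Γ]

theorem sum_inv_mul_eq {M : Type*} [AddCommMonoid M] {S : Finset Γ}
    (hsymm : ∀ s ∈ S, s⁻¹ ∈ S) (f : Γ → M) : ∑ s ∈ S, f s⁻¹ = ∑ s ∈ S, f s :=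
  Finset.sum_bij' (fun s _ => s⁻¹) (fun s _ => s⁻¹) hsymm hsymm (by simp) (by simp) (by simp)

open Classical in
/-- The Schur test for the adjacency operator of a Cayley graph. -/
theorem norm_sum_leftRegular_le {S : Finset Γ} (hsymm : ∀ s ∈ S, s⁻¹ ∈ S) {G : Γ → ℝ}
    (hG : ∀ g, 0 < G g) {K : ℝ} (hK0 : 0 ≤ K) (hK : ∀ g, ∑ s ∈ S, G (s * g) ≤ K * G g) :
    ‖∑ s ∈ S, leftRegular s‖ ≤ K := by
  refine ContinuousLinearMap.opNorm_le_bound _ hK0 fun f => ?_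
  refine lp.norm_le_of_forall_sum_le (by norm_num) (by positivity) fun F => ?_
  have happ : ∀ g, ((∑ s ∈ S, leftRegular s) f : Γ → ℂ) g = ∑ s ∈ S, f (s⁻¹ * g) := by
    intro g
    rw [sum_apply, lp.coeFn_sum, Finset.sum_apply]
    rfl
  have h2 : ((2 : ℝ≥0∞).toReal) = ((2 : ℕ) : ℝ) := by norm_num
  simp only [happ, h2, Real.rpow_natCast]
  -- A finite set containing every translate `s⁻¹ F`, so that `h = s⁻¹ g` can be substituted in
  -- finite sums.
  set H := S.biUnion fun s => F.image fun g => s⁻¹ * g with hH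
  -- Cauchy–Schwarz with weights `G (s⁻¹ g)`; `hK` is used here and again after exchanging the sums,
  -- whence `K ^ 2`.
  have step1 : ∀ g, ‖∑ s ∈ S, f (s⁻¹ * g)‖ ^ 2 ≤
      ∑ s ∈ S, K * G g * (‖f (s⁻¹ * g)‖ ^ 2 / G (s⁻¹ * g)) := by
    intro g
    calc ‖∑ s ∈ S, f (s⁻¹ * g)‖ ^ 2 ≤ (∑ s ∈ S, ‖f (s⁻¹ * g)‖) ^ 2 := by
          gcongr; exact norm_sum_le _ _
      _ ≤ (∑ s ∈ S, G (s⁻¹ * g)) * ∑ s ∈ S, ‖f (s⁻¹ * g)‖ ^ 2 / G (s⁻¹ * g) := by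
          refine Finset.sum_sq_le_sum_mul_sum_of_sq_le_mul _ (fun s _ => (hG _).le)
            (fun s _ => div_nonneg (sq_nonneg _) (hG _).le) fun s _ => ?_
          rw [mul_div_cancel₀ _ (hG _).ne']
      _ ≤ (K * G g) * ∑ s ∈ S, ‖f (s⁻¹ * g)‖ ^ 2 / G (s⁻¹ * g) := by
          refine mul_le_mul_of_nonneg_right ?_
            (Finset.sum_nonneg fun s _ => div_nonneg (sq_nonneg _) (hG _).le)
          rw [sum_inv_mul_eq hsymm fun s => G (s * g)]
          exact hK g
      _ = _ := Finset.mul_sum _ _ _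
  calc ∑ g ∈ F, ‖∑ s ∈ S, f (s⁻¹ * g)‖ ^ 2
      ≤ ∑ g ∈ F, ∑ s ∈ S, K * G g * (‖f (s⁻¹ * g)‖ ^ 2 / G (s⁻¹ * g)) :=
        Finset.sum_le_sum fun g _ => step1 g
    _ = ∑ s ∈ S, ∑ g ∈ F, K * G g * (‖f (s⁻¹ * g)‖ ^ 2 / G (s⁻¹ * g)) := Finset.sum_comm
    _ ≤ ∑ s ∈ S, ∑ h ∈ H, K * G (s * h) * (‖f h‖ ^ 2 / G h) := by
        refine Finset.sum_le_sum fun s hs => ?_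
        calc ∑ g ∈ F, K * G g * (‖f (s⁻¹ * g)‖ ^ 2 / G (s⁻¹ * g))
            = ∑ h ∈ F.image fun g => s⁻¹ * g, K * G (s * h) * (‖f h‖ ^ 2 / G h) := by
              rw [Finset.sum_image fun x _ y _ h => mul_left_cancel h]
              simp
          _ ≤ _ := by
              refine Finset.sum_le_sum_of_subset_of_nonneg
                (Finset.subset_biUnion_of_mem (fun s => F.image fun g => s⁻¹ * g) hs) fun h _ _ => ?_
              exact mul_nonneg (mul_nonneg hK0 (hG _).le) (div_nonneg (sq_nonneg _) (hG _).le)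
    _ = ∑ h ∈ H, K * (∑ s ∈ S, G (s * h)) * (‖f h‖ ^ 2 / G h) := by
        rw [Finset.sum_comm]
        simp only [Finset.mul_sum, Finset.sum_mul]
    _ ≤ ∑ h ∈ H, K ^ 2 * ‖f h‖ ^ 2 := by
        refine Finset.sum_le_sum fun h _ => ?_
        calc K * (∑ s ∈ S, G (s * h)) * (‖f h‖ ^ 2 / G h)
            ≤ K * (K * G h) * (‖f h‖ ^ 2 / G h) :=
              mul_le_mul_of_nonneg_right (mul_le_mul_of_nonneg_left (hK h) hK0)
                (div_nonneg (sq_nonneg _) (hG _).le)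
          _ = _ := by have := (hG h).ne'; field_simp
    _ ≤ (K * ‖f‖) ^ 2 := by
        rw [← Finset.mul_sum, mul_pow]
        gcongr
        have := lp.sum_rpow_le_norm_rpow (p := 2) (by norm_num) f H
        simpa only [h2, Real.rpow_natCast] using this

end SchurTest

/-! ### Generating function of reduced words and the cogrowth bound. -/

section Cogrowth

open Classical in
theorem sum_tsum_cons_le {α : Type*} (S : Finset α) (F : List α → ℝ≥0∞) :
    ∑ s ∈ S, ∑' w, F (s :: w) ≤ ∑' w, if w = [] then 0 else F w := by
  have h : ∑ s ∈ S, ∑' w, F (s :: w) ≤ ∑' s, ∑' w, F (s :: w) := ENNReal.sum_le_tsum S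
  refine h.trans ?_
  rw [← ENNReal.tsum_prod]
  have hinj : Function.Injective (fun p : α × List α => p.1 :: p.2) := by
    rintro ⟨a, v⟩ ⟨b, w⟩ h
    simpa using h
  refine le_trans (le_of_eq ?_) (ENNReal.tsum_comp_le_tsum_of_injective hinj _)
  simp

variable {Γ : Type*} [Group Γ]

/-- Reduced words in the letters of `S`. -/
def IsReducedWord (S : Finset Γ) (w : List Γ) : Prop :=
  (∀ s ∈ w, s ∈ S) ∧ w.IsChain (fun s t => t ≠ s⁻¹)

open Classical in
/-- The weight `t ^ |w|` of the reduced words with product `g`, and `0` on other words. -/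
noncomputable def wordWeight (S : Finset Γ) (t : ℝ≥0∞) (g : Γ) (w : List Γ) : ℝ≥0∞ :=
  if IsReducedWord S w ∧ w.prod = g then t ^ w.length else 0

/-- The generating function `∑ t ^ |w|` over the reduced words `w` with product `g`. -/
noncomputable def reducedSeries (S : Finset Γ) (t : ℝ≥0∞) (g : Γ) : ℝ≥0∞ :=
  ∑' w, wordWeight S t g w

theorem isReducedWord_cons_cons {S : Finset Γ} {s r : Γ} {w : List Γ} :
    IsReducedWord S (s :: r :: w) ↔ s ∈ S ∧ r ≠ s⁻¹ ∧ IsReducedWord S (r :: w) := by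
  simp only [IsReducedWord, List.isChain_cons_cons, List.forall_mem_cons]
  tauto

theorem IsReducedWord.tail {S : Finset Γ} {s : Γ} {w : List Γ} (h : IsReducedWord S (s :: w)) :
    IsReducedWord S w :=
  ⟨fun r hr => h.1 r (List.mem_cons_of_mem _ hr), h.2.tail⟩

/-- A reduced word not starting with `s` stays reduced when `s⁻¹` is prepended; the extra letter
accounts for `t⁻¹`. -/
theorem wordWeight_le_cons {S : Finset Γ} {s : Γ} (hs : s⁻¹ ∈ S) {t : ℝ≥0∞}
    (ht0 : t ≠ 0) (ht : t ≠ ∞) (g : Γ) {w : List Γ} (hw : ∀ v, w ≠ s :: v) :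
    wordWeight S t (s * g) w ≤ t⁻¹ * wordWeight S t g (s⁻¹ :: w) := by
  by_cases h : IsReducedWord S w ∧ w.prod = s * g
  · have h' : IsReducedWord S (s⁻¹ :: w) ∧ (s⁻¹ :: w).prod = g := by
      refine ⟨?_, by simp [h.2]⟩
      cases w with
      | nil => exact ⟨by simpa using hs, by simp⟩
      | cons r v =>
        refine isReducedWord_cons_cons.2 ⟨hs, ?_, h.1⟩
        rintro rfl
        exact hw v (by simp)
    rw [wordWeight, if_pos h, wordWeight, if_pos h', List.length_cons, pow_succ', ← mul_assoc,
      ENNReal.inv_mul_cancel ht0 ht, one_mul]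
  · rw [wordWeight, if_neg h]
    exact zero_le

open Classical in
theorem wordWeight_cons (S : Finset Γ) (s : Γ) (t : ℝ≥0∞) (g : Γ) (w : List Γ) :
    wordWeight S t (s * g) (s :: w) =
      if IsReducedWord S (s :: w) then t * wordWeight S t g w else 0 := by
  by_cases h : IsReducedWord S (s :: w)
  · have := h.tail
    simp only [wordWeight, h, this, true_and, if_true, List.prod_cons, mul_right_inj,
      List.length_cons, pow_succ', mul_ite, mul_zero]
  · simp [wordWeight, h]

/-- Words with product `s g` are split according to whether their first letter is `s`. -/
theorem reducedSeries_mul_le {S : Finset Γ} {s : Γ} (hs : s⁻¹ ∈ S) {t : ℝ≥0∞}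
    (ht0 : t ≠ 0) (ht : t ≠ ∞) (g : Γ) :
    reducedSeries S t (s * g) ≤ t⁻¹ * ∑' w, wordWeight S t g (s⁻¹ :: w) +
      ∑' w, wordWeight S t (s * g) (s :: w) := by
  classical
  have h1 : ∑' w, wordWeight S t (s * g) (s :: w) =
      ∑' w, Set.indicator (Set.range (List.cons s)) (wordWeight S t (s * g)) w := by
    rw [← Function.Injective.tsum_eq (List.cons_injective (a := s))
      (f := Set.indicator (Set.range (List.cons s)) (wordWeight S t (s * g)))
      Set.support_indicator_subset]
    simp
  rw [h1, ← ENNReal.tsum_mul_left, ← ENNReal.tsum_add]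
  refine ENNReal.tsum_le_tsum fun w => ?_
  by_cases hw : w ∈ Set.range (List.cons s)
  · rw [Set.indicator_of_mem hw]
    exact le_add_self
  · rw [Set.indicator_of_notMem hw, add_zero]
    exact wordWeight_le_cons hs ht0 ht g fun v hv => hw ⟨v, hv.symm⟩

open Classical in
-- Any letter may precede the empty word; before a nonempty one, the inverse of its head is
-- forbidden.
theorem sum_wordWeight_cons_le {S : Finset Γ} (hsymm : ∀ s ∈ S, s⁻¹ ∈ S) (t : ℝ≥0∞) (g : Γ)
    (w : List Γ) :
    ∑ s ∈ S, wordWeight S t (s * g) (s :: w) ≤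
      (if w = [] then (S.card : ℝ≥0∞) else ((S.card - 1 : ℕ) : ℝ≥0∞)) * t * wordWeight S t g w := by
  by_cases hw : IsReducedWord S w
  swap
  · refine le_of_eq_of_le (Finset.sum_eq_zero fun s _ => ?_) zero_le
    rw [wordWeight_cons, if_neg fun h => hw h.tail]
  simp only [wordWeight_cons, ← Finset.sum_filter, Finset.sum_const, nsmul_eq_mul, mul_assoc]
  gcongr
  split_ifs with h
  · exact_mod_cast Finset.card_filter_le _ _
  · obtain ⟨r, v, rfl⟩ := List.exists_cons_of_ne_nil h
    have hr : r⁻¹ ∈ S := hsymm r (hw.1 r (by simp))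
    rw [← Finset.card_erase_of_mem hr]
    refine Nat.cast_le.2 (Finset.card_le_card fun s hs => ?_)
    rw [Finset.mem_filter] at hs
    rw [Finset.mem_erase]
    refine ⟨?_, hs.1⟩
    rintro rfl
    exact (isReducedWord_cons_cons.1 hs.2).2.1 (by simp)

/-- The generating function of reduced words is superharmonic for the adjacency operator of the
Cayley graph, up to the factor `(|S| - 1) t + 1 / t`. -/
theorem sum_reducedSeries_le {S : Finset Γ} (hS : S.Nonempty) (hsymm : ∀ s ∈ S, s⁻¹ ∈ S)
    {t : ℝ≥0∞} (ht0 : t ≠ 0) (ht : t ≤ 1) (g : Γ) :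
    ∑ s ∈ S, reducedSeries S t (s * g) ≤
      (((S.card - 1 : ℕ) : ℝ≥0∞) * t + t⁻¹) * reducedSeries S t g := by
  classical
  have htop : t ≠ ∞ := ne_top_of_le_ne_top ENNReal.one_ne_top ht
  calc ∑ s ∈ S, reducedSeries S t (s * g)
      ≤ ∑ s ∈ S, (t⁻¹ * ∑' w, wordWeight S t g (s⁻¹ :: w) +
          ∑' w, wordWeight S t (s * g) (s :: w)) :=
        Finset.sum_le_sum fun s hs => reducedSeries_mul_le (hsymm s hs) ht0 htop g
    _ = t⁻¹ * ∑ s ∈ S, ∑' w, wordWeight S t g (s :: w) +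
          ∑' w, ∑ s ∈ S, wordWeight S t (s * g) (s :: w) := by
        rw [Finset.sum_add_distrib, ← Finset.mul_sum,
          sum_inv_mul_eq hsymm fun s => ∑' w, wordWeight S t g (s :: w),
          Summable.tsum_finsetSum fun _ _ => ENNReal.summable]
    _ ≤ t⁻¹ * (∑' w, if w = [] then 0 else wordWeight S t g w) +
          ∑' w, (if w = [] then (S.card : ℝ≥0∞) else ((S.card - 1 : ℕ) : ℝ≥0∞)) * t *
            wordWeight S t g w := by
        gcongr with w
        · exact sum_tsum_cons_le S _
        · exact sum_wordWeight_cons_le hsymm t g w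
    _ ≤ _ := by
        rw [reducedSeries, ← ENNReal.tsum_mul_left, ← ENNReal.tsum_mul_left, ← ENNReal.tsum_add]
        refine ENNReal.tsum_le_tsum fun w => ?_
        split_ifs with h
        -- The empty word admits one letter more, but has no `t⁻¹` term from the first sum; `t ≤ 1 ≤
        -- t⁻¹` absorbs the excess.
        · rw [mul_zero, zero_add]
          gcongr
          have : (S.card : ℝ≥0∞) = ((S.card - 1 : ℕ) : ℝ≥0∞) + 1 := by
            rw [← Nat.cast_add_one, Nat.sub_add_cancel hS.card_pos]
          rw [this, add_mul, one_mul]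
          gcongr
          exact ht.trans (ENNReal.one_le_inv.2 ht)
        · rw [add_mul, add_comm]

theorem induction_of_symm_generating {S : Finset Γ} (hsymm : ∀ s ∈ S, s⁻¹ ∈ S)
    (hgen : Subgroup.closure (S : Set Γ) = ⊤) {P : Γ → Prop} (h1 : P 1)
    (hP : ∀ s ∈ S, ∀ g, P g → P (s * g)) (g : Γ) : P g := by
  have hg : g ∈ Subgroup.closure (S : Set Γ) := hgen ▸ Subgroup.mem_top g
  induction hg using Subgroup.closure_induction_left with
  | one => exact h1
  | mul_left s hs g _ ih => exact hP s hs g ih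
  | inv_mul_cancel s hs g _ ih => exact hP _ (hsymm s hs) g ih

theorem one_le_reducedSeries_one (S : Finset Γ) (t : ℝ≥0∞) : 1 ≤ reducedSeries S t 1 := by
  refine le_trans ?_ (ENNReal.le_tsum [])
  simp [wordWeight, IsReducedWord]

/-- The norm of the adjacency operator is at most `(|S| - 1) t + 1 / t` as soon as the generating
function of the trivial reduced words converges at `t`. -/
theorem norm_sum_leftRegular_le_of_reducedSeries {S : Finset Γ} (hS : S.Nonempty)
    (hsymm : ∀ s ∈ S, s⁻¹ ∈ S) (hgen : Subgroup.closure (S : Set Γ) = ⊤) {t : ℝ}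
    (ht0 : 0 < t) (ht : t ≤ 1) (hfin : reducedSeries S (ENNReal.ofReal t) 1 ≠ ∞) :
    ‖∑ s ∈ S, leftRegular s‖ ≤ ((S.card : ℝ) - 1) * t + t⁻¹ := by
  set T := ENNReal.ofReal t with hT
  have hT0 : T ≠ 0 := by simpa [hT] using ht0
  have hT1 : T ≤ 1 := by simpa [hT] using ht
  set K : ℝ≥0∞ := ((S.card - 1 : ℕ) : ℝ≥0∞) * T + T⁻¹ with hK
  have hKtop : K ≠ ∞ := by
    refine ENNReal.add_ne_top.2 ⟨ENNReal.mul_ne_top (ENNReal.natCast_ne_top _) ?_, by simpa⟩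
    exact ENNReal.ofReal_ne_top
  have hsum := sum_reducedSeries_le hS hsymm hT0 hT1
  have hle : ∀ s ∈ S, ∀ g, reducedSeries S T (s * g) ≤ K * reducedSeries S T g := fun s hs g =>
    le_trans (Finset.single_le_sum (f := fun s => reducedSeries S T (s * g))
      (fun _ _ => zero_le) hs) (hsum g)
  -- Finiteness and nonvanishing spread from `1` along the edges of the connected Cayley graph.
  have htop : ∀ g, reducedSeries S T g ≠ ∞ := by
    refine induction_of_symm_generating hsymm hgen hfin fun s hs g hg => ?_
    exact ne_top_of_le_ne_top (ENNReal.mul_ne_top hKtop hg) (hle s hs g)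
  have hne : ∀ g, reducedSeries S T g ≠ 0 := by
    refine induction_of_symm_generating hsymm hgen
      (zero_lt_one.trans_le (one_le_reducedSeries_one S T)).ne' fun s hs g hg h0 => hg ?_
    have := hle s⁻¹ (hsymm s hs) (s * g)
    rwa [inv_mul_cancel_left, h0, mul_zero, nonpos_iff_eq_zero] at this
  have hKr : K.toReal = ((S.card : ℝ) - 1) * t + t⁻¹ := by
    rw [hK, ENNReal.toReal_add (by finiteness) (by simpa), ENNReal.toReal_mul,
      ENNReal.toReal_inv, hT, ENNReal.toReal_ofReal ht0.le, ENNReal.toReal_natCast,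
      Nat.cast_sub hS.card_pos, Nat.cast_one]
  rw [← hKr]
  refine norm_sum_leftRegular_le hsymm (G := fun g => (reducedSeries S T g).toReal)
    (fun g => ENNReal.toReal_pos (hne g) (htop g)) ENNReal.toReal_nonneg fun g => ?_
  rw [← ENNReal.toReal_mul, ← ENNReal.toReal_sum fun s _ => htop _]
  exact ENNReal.toReal_mono (ENNReal.mul_ne_top hKtop (htop g)) (hsum g)

theorem trivialReducedWords_subset (S : Finset Γ) (i : ℕ) :
    trivialReducedWords S i ⊆ Set.range fun f : Fin i → S => List.ofFn fun j => (f j : Γ) := by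
  rintro w ⟨rfl, hw, -⟩
  refine ⟨fun j => ⟨w.get j, hw _ (w.get_mem j)⟩, ?_⟩
  exact List.ofFn_get w

theorem finite_trivialReducedWords (S : Finset Γ) (i : ℕ) : (trivialReducedWords S i).Finite :=
  (Set.finite_range _).subset (trivialReducedWords_subset S i)

theorem numTrivial_le (S : Finset Γ) (i : ℕ) : numTrivial S i ≤ S.card ^ i := by
  refine (Set.ncard_le_ncard (trivialReducedWords_subset S i) (Set.finite_range _)).trans ?_
  rw [← Set.image_univ]
  refine (Set.ncard_image_le Set.finite_univ).trans ?_
  simp [Set.ncard_univ]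

theorem reducedSeries_one_eq (S : Finset Γ) (t : ℝ≥0∞) :
    reducedSeries S t 1 = ∑' i, (numTrivial S i : ℝ≥0∞) * t ^ i := by
  classical
  have h1 : ∀ w, wordWeight S t 1 w =
      ∑' i, Set.indicator (trivialReducedWords S i) (fun _ => t ^ i) w := by
    intro w
    rw [tsum_eq_single w.length]
    · simp only [wordWeight, Set.indicator, trivialReducedWords, IsReducedWord, Set.mem_ofPred_eq,
        true_and, and_assoc]
    · intro i hi
      rw [Set.indicator_of_notMem]
      exact fun h => hi h.1.symm
  rw [reducedSeries, tsum_congr h1, ENNReal.tsum_comm]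
  refine tsum_congr fun i => ?_
  rw [← tsum_subtype, ENNReal.tsum_set_const, numTrivial,
    ← (finite_trivialReducedWords S i).cast_ncard_eq]
  rfl

theorem reducedSeries_ne_top {S : Finset Γ} {b : ℝ} (hb0 : 0 < b) (hb : cogrowthRate S < b) :
    reducedSeries S (ENNReal.ofReal b⁻¹) 1 ≠ ∞ := by
  suffices h : Summable fun i => (numTrivial S i : ℝ) * b⁻¹ ^ i by
    have := h.tsum_ofReal_ne_top
    rw [reducedSeries_one_eq]
    convert this using 3 with i
    rw [ENNReal.ofReal_mul (by positivity), ENNReal.ofReal_natCast,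
      ENNReal.ofReal_pow (by positivity)]
  unfold cogrowthRate at hb
  split_ifs at hb with hex
  -- Root test: eventually `r_i ≤ d ^ i` with `d < b`; the maximum with `0` makes `d` positive.
  · obtain ⟨d, hd, hdb⟩ := exists_between (max_lt hb hb0)
    have hd0 : 0 < d := (le_max_right _ _).trans_lt hd
    have hbdd : Filter.IsBoundedUnder (· ≤ ·) Filter.atTop
        (fun i : ℕ => (numTrivial S i : ℝ) ^ (1 / (i : ℝ))) := by
      refine Filter.isBoundedUnder_of_eventually_le (a := (S.card : ℝ)) ?_
      filter_upwards [Filter.eventually_ge_atTop 1] with i hi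
      have hi0 : i ≠ 0 := by omega
      calc (numTrivial S i : ℝ) ^ (1 / (i : ℝ)) ≤ ((S.card : ℝ) ^ i) ^ (1 / (i : ℝ)) := by
            gcongr
            exact_mod_cast numTrivial_le S i
        _ = S.card := by
            rw [one_div, Real.pow_rpow_inv_natCast (by positivity) hi0]
    have hev := Filter.eventually_lt_of_limsup_lt ((le_max_left _ _).trans_lt hd) hbdd
    have hgeo : Summable fun i : ℕ => (d / b) ^ i :=
      summable_geometric_of_lt_one (by positivity) ((div_lt_one hb0).2 hdb)
    refine Summable.of_norm_bounded_eventually_nat hgeo ?_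
    filter_upwards [hev, Filter.eventually_ge_atTop 1] with i hi h1
    have hi0 : i ≠ 0 := by omega
    rw [Real.norm_of_nonneg (by positivity), inv_pow, ← div_eq_mul_inv, div_pow]
    gcongr
    calc (numTrivial S i : ℝ) = ((numTrivial S i : ℝ) ^ (1 / (i : ℝ))) ^ i := by
          rw [one_div, Real.rpow_inv_natCast_pow (by positivity) hi0]
      _ ≤ d ^ i := by gcongr
  -- In the free case only the empty word contributes.
  · push Not at hex
    refine summable_of_ne_finset_zero (s := {0}) fun i hi => ?_
    rw [hex i (by simp at hi; omega)]
    simp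

/-- A form of the cogrowth formula. -/
theorem norm_sum_leftRegular_le_cogrowthRate {S : Finset Γ} (hS : 2 ≤ S.card)
    (hsymm : ∀ s ∈ S, s⁻¹ ∈ S) (hgen : Subgroup.closure (S : Set Γ) = ⊤) :
    ‖∑ s ∈ S, leftRegular s‖ ≤ 2 * max (cogrowthRate S) (Real.sqrt ((S.card : ℝ) - 1)) := by
  have hq : (1 : ℝ) ≤ (S.card : ℝ) - 1 := by
    have : (2 : ℝ) ≤ S.card := by exact_mod_cast hS
    linarith
  suffices h : ∀ b, max (cogrowthRate S) (Real.sqrt ((S.card : ℝ) - 1)) < b →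
      ‖∑ s ∈ S, leftRegular s‖ / 2 ≤ b by
    have := le_of_forall_gt_imp_ge_of_dense h
    linarith
  intro b hb
  have hb1 : 1 ≤ b := (Real.one_le_sqrt.2 hq).trans ((le_max_right _ _).trans hb.le)
  have hb0 : 0 < b := by linarith
  have hfin := reducedSeries_ne_top hb0 ((le_max_left _ _).trans_lt hb)
  -- With `t = 1 / b` the bound is `(n - 1) / b + b ≤ 2 b`, since `b ≥ √(n - 1)`.
  have h := norm_sum_leftRegular_le_of_reducedSeries (Finset.card_pos.1 (by omega)) hsymm hgen
    (inv_pos.2 hb0) (inv_le_one_of_one_le₀ hb1) hfin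
  rw [inv_inv] at h
  have hqb : (S.card : ℝ) - 1 ≤ b ^ 2 :=
    (Real.sqrt_le_left hb0.le).1 ((le_max_right _ _).trans hb.le)
  have : ((S.card : ℝ) - 1) * b⁻¹ ≤ b := by
    rw [← div_eq_mul_inv, div_le_iff₀ hb0]
    linarith
  linarith

end Cogrowth

/-! ### From the norm estimate to the lower bound. -/

section LowerBound

variable {Γ : Type*} [Group Γ]

theorem mem_sphere_one {S : Finset Γ} (hone : (1 : Γ) ∉ S) {s : Γ} (hs : s ∈ S) :
    s ∈ sphere S 1 := by
  have h1 : (1 : ℕ) ∈ {k : ℕ | s ∈ (S : Set Γ) ^ k} := by simpa using hs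
  refine le_antisymm (Nat.sInf_le h1) (le_csInf ⟨1, h1⟩ fun k hk => ?_)
  rw [Nat.one_le_iff_ne_zero]
  rintro rfl
  rw [Set.mem_ofPred_eq, pow_zero, Set.mem_one] at hk
  exact hone (hk ▸ hs)

theorem exp_neg_le_norm_of_phiPlus_eq {S : Finset Γ} {φ : Γ → ℂ} {i : ℕ} {a : ℝ}
    (haφ : phiPlus S φ i = (a : EReal)) {s : Γ} (hs : s ∈ sphere S i) :
    Real.exp (-a) ≤ ‖φ s‖ := by
  have h1 : ⨅ g ∈ sphere S i, ENNReal.log ‖φ g‖ₑ = ((-a : ℝ) : EReal) := by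
    rw [EReal.coe_neg, ← haφ, phiPlus, neg_neg]
  have h2 : ((-a : ℝ) : EReal) ≤ ENNReal.log ‖φ s‖ₑ := h1 ▸ iInf₂_le s hs
  rw [← Real.log_exp (-a), ← ENNReal.log_ofReal_of_pos (Real.exp_pos _),
    ENNReal.log_le_log_iff, ← ofReal_norm] at h2
  exact (ENNReal.ofReal_le_ofReal_iff (norm_nonneg _)).1 h2

open Classical in
/-- The canonical trace `y ↦ ⟨δ_e, y δ_e⟩` of `L(Γ)`. -/
noncomputable def canonicalTrace (Γ : Type*) [Group Γ] :
    (groupVonNeumannAlgebra Γ).toStarSubalgebra →ₗ[ℂ] ℂ where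
  toFun y := (y : ℓ²(Γ, ℂ) →L[ℂ] ℓ²(Γ, ℂ)) (lp.single 2 1 1) 1
  map_add' _ _ := rfl
  map_smul' _ _ := rfl

theorem norm_canonicalTrace_le (y : (groupVonNeumannAlgebra Γ).toStarSubalgebra) :
    ‖canonicalTrace Γ y‖ ≤ ‖y‖ := by
  classical
  refine (lp.norm_apply_le_norm two_ne_zero _ _).trans ?_
  refine ((y : ℓ²(Γ, ℂ) →L[ℂ] ℓ²(Γ, ℂ)).le_opNorm _).trans_eq ?_
  rw [lp.norm_single (by norm_num), norm_one, mul_one]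
  rfl

theorem canonicalTrace_groupUnitary (g : Γ) :
    canonicalTrace Γ (groupUnitary g) = diracOne g := by
  classical
  change (lp.single 2 (1 : Γ) (1 : ℂ) : ℓ²(Γ, ℂ)) (g⁻¹ * 1) = _
  rw [mul_one, lp.single_apply, diracOne]
  by_cases h : g = 1
  · subst h; simp
  · rw [Set.indicator_of_notMem (by simpa using h), Pi.single_eq_of_ne (by simpa using h)]

/-- If `ψ - δ_e` extends to a bounded functional on `L(Γ)`, for `ψ` positive definite, then `ψ` is
dominated by the norm on self-adjoint elements of the group algebra. -/
theorem IsPositiveDefinite.sum_re_le {ψ : Γ → ℂ} (hψ : IsPositiveDefinite ψ) {S : Finset Γ}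
    (hsymm : ∀ s ∈ S, s⁻¹ ∈ S) (Φ : (groupVonNeumannAlgebra Γ).toStarSubalgebra →L[ℂ] ℂ)
    (hΦ : ∀ g, Φ (groupUnitary g) = ψ g - diracOne g) :
    ∑ s ∈ S, (ψ s).re ≤ (ψ 1).re * ‖∑ s ∈ S, leftRegular s‖ := by
  set Ψ : (groupVonNeumannAlgebra Γ).toStarSubalgebra →ₗ[ℂ] ℂ :=
    (Φ : (groupVonNeumannAlgebra Γ).toStarSubalgebra →ₗ[ℂ] ℂ) + canonicalTrace Γ with hΨdef
  have hΨ : ∀ g, Ψ (groupUnitaryHom Γ g) = ψ g := by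
    intro g
    change Φ (groupUnitary g) + canonicalTrace Γ (groupUnitary g) = ψ g
    rw [hΦ, canonicalTrace_groupUnitary, sub_add_cancel]
  have hC : ∀ y, ‖Ψ y‖ ≤ (‖Φ‖ + 1) * ‖y‖ := by
    intro y
    rw [add_mul, one_mul]
    exact (norm_add_le _ _).trans (add_le_add (Φ.le_opNorm y) (norm_canonicalTrace_le y))
  have hmem : ∑ s ∈ S, groupUnitaryHom Γ s ∈ Submodule.span ℂ (Set.range (groupUnitaryHom Γ)) :=
    sum_mem fun s _ => Submodule.subset_span ⟨s, rfl⟩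
  have hnorm : ‖∑ s ∈ S, groupUnitaryHom Γ s‖ ≤ ‖∑ s ∈ S, leftRegular s‖ := by
    change ‖((∑ s ∈ S, groupUnitaryHom Γ s :
      (groupVonNeumannAlgebra Γ).toStarSubalgebra) : ℓ²(Γ, ℂ) →L[ℂ] ℓ²(Γ, ℂ))‖ ≤ _
    rw [AddSubmonoidClass.coe_finsetSum]
    rfl
  have h := hψ.re_map_le star_groupUnitaryHom Ψ hΨ (by positivity) hC hmem
    (isSelfAdjoint_sum_groupUnitaryHom S hsymm) hnorm
  rw [map_sum, Complex.re_sum] at h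
  simpa only [hΨ] using h

/-- With `B = 4 (2 + 3 γ² / n) D`, the hypothesis yields `m² B ≥ 2`, and `1 - 2 / m² ≤ (m - 1) / 2`
for every `m > 0`. -/
theorem lower_bound_of_le {n m γ D : ℝ} (hn : 1 < n) (hm : 0 ≤ m) (hD : 0 < D)
    (h : n ^ 2 ≤ (n - 1) * D * (m * (2 * max γ (Real.sqrt (n - 1)))) ^ 2) :
    1 - 4 * (2 + 3 * (γ ^ 2 / n)) * D ≤ (m - 1) / 2 := by
  have hn0 : 0 < n := by linarith
  have key : 2 ≤ m ^ 2 * (4 * (2 + 3 * (γ ^ 2 / n)) * D) := by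
    have hγ : 0 ≤ γ ^ 2 / n := by positivity
    -- If `γ` is the maximum, the summand `12 γ² D / n` of `B` suffices; otherwise `8 D` does.
    rcases max_choice γ (Real.sqrt (n - 1)) with h' | h' <;> rw [h'] at h
    · have h1 : n * n ≤ n * (4 * m ^ 2 * γ ^ 2 * D) := by
        calc n * n ≤ (n - 1) * (4 * m ^ 2 * γ ^ 2 * D) := by linarith
          _ ≤ _ := by gcongr; linarith
      have h2 : 1 ≤ 4 * m ^ 2 * D * (γ ^ 2 / n) := by
        rw [← mul_div_assoc, le_div_iff₀ hn0]
        linarith [le_of_mul_le_mul_left h1 hn0]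
      have h3 : 0 ≤ m ^ 2 * D := by positivity
      linarith
    · have hs := Real.sq_sqrt (by linarith : 0 ≤ n - 1)
      rw [mul_pow, mul_pow, hs] at h
      have h1 : n ^ 2 * 1 ≤ n ^ 2 * (4 * m ^ 2 * D) := by
        calc n ^ 2 * 1 ≤ (n - 1) ^ 2 * (4 * m ^ 2 * D) := by linarith
          _ ≤ _ := by gcongr; linarith
      have h2 := le_of_mul_le_mul_left h1 (by positivity)
      have h3 : 0 ≤ m ^ 2 * D * (γ ^ 2 / n) := by positivity
      linarith
  rcases hm.eq_or_lt with rfl | hm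
  · norm_num at key
  -- This is `m³ - 3 m² + 4`, i.e. `2 m²` times `(m - 1) / 2 - 1 + 2 / m²`.
  have hcub : 0 ≤ (m - 2) ^ 2 * (m + 1) := by positivity
  have : m ^ 2 * (1 - 4 * (2 + 3 * (γ ^ 2 / n)) * D) ≤ m ^ 2 * ((m - 1) / 2) := by
    linarith
  exact le_of_mul_le_mul_left this (by positivity)

end LowerBound

end DualCutoff

theorem mainTheorem6 {Γ : Type*} [Group Γ] (S : Finset Γ)
    (hone : (1 : Γ) ∉ S)
    (hsymm : ∀ s ∈ S, s⁻¹ ∈ S)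
    (hgen : Subgroup.closure (S : Set Γ) = ⊤)
    (φ : Γ → ℂ) (hφ : DualCutoff.IsPositiveDefinite φ)
    (hnonneg : ∀ g ∈ S, 0 ≤ φ g)
    (a : ℝ) (ha : 0 < a) (haφ : DualCutoff.phiPlus S φ 1 = (a : EReal))
    (c : ℝ) (hc : 0 < c) (k : ℕ)
    (hk : (k : ℝ) = Real.log ((S.card : ℝ) - 1) / (2 * a) - c) :
    ENNReal.ofReal
        (1 - 4 * (2 + 3 * (DualCutoff.cogrowthRate S ^ 2 / (S.card : ℝ))) *
          Real.exp (-2 * a * c)) ≤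
      DualCutoff.tvNorm (fun g => φ g ^ k - DualCutoff.diracOne g) := by
  open DualCutoff in
  refine le_iInf₂ fun Φ hΦ => ENNReal.ofReal_le_ofReal ?_
  have hψ := hφ.pow k
  have hψ1 := Complex.nonneg_iff.1 hψ.apply_one_nonneg
  set m := (φ 1 ^ k).re with hm
  have hlog : Real.log ((S.card : ℝ) - 1) = 2 * a * (k + c) := by
    rw [hk]; field_simp; ring
  have hcard : 2 ≤ S.card := by
    -- For `|S| ≤ 1` the logarithm is `log (-1)` or `log 0`, both `0` by convention, yet it must be
    -- positive.
    by_contra! hlt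
    have hpos : 0 < Real.log ((S.card : ℝ) - 1) := by rw [hlog]; positivity
    interval_cases S.card <;> norm_num at hpos
  have hn : (1 : ℝ) < S.card := by exact_mod_cast hcard
  have hq : (0 : ℝ) < (S.card : ℝ) - 1 := by linarith
  have hterm : ∀ s ∈ S, Real.exp (-a) ^ k ≤ (φ s ^ k).re := by
    intro s hs
    have h1 := exp_neg_le_norm_of_phiPlus_eq haφ (mem_sphere_one hone hs)
    have h2 : φ s = ((‖φ s‖ : ℝ) : ℂ) := (Complex.norm_of_nonneg' (hnonneg s hs)).symm
    rw [h2, ← Complex.ofReal_pow, Complex.ofReal_re]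
    gcongr
  have hsum : (S.card : ℝ) * Real.exp (-a) ^ k ≤
      m * (2 * max (cogrowthRate S) (Real.sqrt ((S.card : ℝ) - 1))) := by
    rw [← nsmul_eq_mul]
    refine (Finset.card_nsmul_le_sum S _ _ hterm).trans ((hψ.sum_re_le hsymm Φ hΦ).trans ?_)
    exact mul_le_mul_of_nonneg_left
      (norm_sum_leftRegular_le_cogrowthRate hcard hsymm hgen) hψ1.1
  have hexp : ((S.card : ℝ) - 1) * Real.exp (-2 * a * c) * (Real.exp (-a) ^ k) ^ 2 = 1 := by
    rw [← Real.exp_log hq, hlog, ← Real.exp_nat_mul, ← Real.exp_nat_mul, ← Real.exp_add,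
      ← Real.exp_add, Real.exp_eq_one_iff]
    push_cast
    ring
  have hbound : (m - 1) / 2 ≤ ‖Φ‖ / 2 := by
    have h1 := Φ.le_opNorm (groupUnitary 1)
    have h2 : ‖groupUnitary (1 : Γ)‖ ≤ 1 :=
      (leftRegularIsometry (1 : Γ)).norm_toContinuousLinearMap_le
    have h3 : m - 1 ≤ ‖Φ (groupUnitary 1)‖ := by
      rw [hΦ]
      refine le_trans (le_of_eq ?_) (Complex.re_le_norm _)
      change m - 1 = (φ 1 ^ k - Set.indicator {1} 1 (1 : Γ)).re
      rw [Set.indicator_of_mem (Set.mem_singleton 1), Complex.sub_re, ← hm]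
      rfl
    have h4 : ‖Φ‖ * ‖groupUnitary (1 : Γ)‖ ≤ ‖Φ‖ :=
      mul_le_of_le_one_right (norm_nonneg _) h2
    linarith
  refine le_trans (lower_bound_of_le hn hψ1.1 (Real.exp_pos _) ?_) hbound
  calc (S.card : ℝ) ^ 2 = ((S.card : ℝ) - 1) * Real.exp (-2 * a * c) *
        ((S.card : ℝ) * Real.exp (-a) ^ k) ^ 2 := by
        rw [mul_pow, mul_left_comm, hexp, mul_one]
    _ ≤ _ := mul_le_mul_of_nonneg_left (pow_le_pow_left₀
        (mul_nonneg (Nat.cast_nonneg _) (pow_nonneg (Real.exp_pos _).le _)) hsum 2)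
        (mul_pos hq (Real.exp_pos _)).le
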